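/- Let $d\ge 2$ be an integer, $p=d-1$, $\lambda>0$ and $u>0$. Let $\mathrm{NDFHL}^{(d)}(\lambda,u)$ denote the probability distribution on $\mathbb{R}^{p}$ with density $$f(\mathbf n)=\frac{\lambda}{2^{d/2-1}\pi^{d/2}}\left(\frac{u}{\rho(\mathbf n)}\right)^{d/2}e^{\lambda u}K_{d/2}\bigl(u\,\rho(\mathbf n)\bigr),\qquad \rho(\mathbf n)=\sqrt{\|\mathbf n\|^2+\lambda^2},$$ where $K_\nu$ is the modified Bessel function of the second kind of order $\nu$. For $P>0$ let $\mathbf X\sim\mathcal N\bigl(\mathbf 0,\tfrac{P}{p}\mathbf I_p\bigr)$ and $\mathbf N\sim\mathrm{NDFHL}^{(d)}(\lambda,u)$ be independent random vectors in $\mathbb R^p$. Then, with mutual information $I$ measured in nats, $$I(\mathbf X;\mathbf X+\mathbf N)\ \ge\ \frac p2\log P+O(1),\qquad P\to\infty,$$ where the $O(1)$ term depends only on $d$, $\lambda$, $u$ and $P$ and stays bounded as $P\to\infty$; that is, there are constants $C,P_0\in\mathbb{R}$ depending only on $d,\lambda,u$ such that $I(\mathbf X;\mathbf X+\mathbf N)\ge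 \frac p2\log P-C$ for all $P\ge P_0$. -/

import Mathlib

open MeasureTheory ProbabilityTheory InformationTheory Filter Asymptotics
open scoped ENNReal

noncomputable section

/-- The modified Bessel function of the second kind `K_ν(z)` of real order `ν` at `z > 0`, through
the classical integral representation
`K_ν(z) = (1/2) (z/2)^ν ∫_0^∞ exp(-t - z^2/(4t)) t^(-ν-1) dt`.
(The substitution `t = (z/2) e^s` turns it into `∫_0^∞ exp(-z cosh s) cosh (ν s) ds`.) -/
def besselK (ν z : ℝ) : ℝ :=
  (1 / 2) * (z / 2) ^ ν *
    ∫ t in Set.Ioi (0 : ℝ), Real.exp (-t - z ^ 2 / (4 * t)) * t ^ (-ν - 1)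

/-- The distance `ρ(n) = √(‖n‖² + lam²)` from the origin of the ambient `d`-dimensional space to
the point `n` of the hyperplane at distance `lam`. -/
def ndfhlRho (d : ℕ) (lam : ℝ) (n : EuclideanSpace ℝ (Fin (d - 1))) : ℝ :=
  √(‖n‖ ^ 2 + lam ^ 2)

/-- The density of the Normally-Drifted First-Hitting Location distribution with ambient dimension
`d`, boundary distance `lam` and normalized drift `u`, on `ℝ^(d-1)`. -/
def ndfhlPDF (d : ℕ) (lam u : ℝ) (n : EuclideanSpace ℝ (Fin (d - 1))) : ℝ :=
  lam / ((2 : ℝ) ^ ((d : ℝ) / 2 - 1) * Real.pi ^ ((d : ℝ) / 2)) *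
    (u / ndfhlRho d lam n) ^ ((d : ℝ) / 2) * Real.exp (lam * u) *
    besselK ((d : ℝ) / 2) (u * ndfhlRho d lam n)

/-- The distribution `NDFHL^(d)(lam, u)` on `ℝ^(d-1)`. -/
def ndfhl (d : ℕ) (lam u : ℝ) : Measure (EuclideanSpace ℝ (Fin (d - 1))) :=
  volume.withDensity fun n => ENNReal.ofReal (ndfhlPDF d lam u n)

/-- The mutual information `I(X; Y)` (in nats) of two random elements on a probability space: the
Kullback-Leibler divergence of their joint law from the product of their marginal laws. -/
def mutualInfo {Ω α β : Type*} [MeasurableSpace Ω] [MeasurableSpace α] [MeasurableSpace β]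
    (X : Ω → α) (Y : Ω → β) (μ : Measure Ω) : ℝ≥0∞ :=
  klDiv (μ.map fun ω => (X ω, Y ω)) ((μ.map X).prod (μ.map Y))

end

/-! Apply the Donsker–Varadhan bound to the test function `g (y - x)` with `g z = -(d/2) log (1 +
‖z‖²)`. Under the joint law it equals `g N`, whose mean does not depend on `P`. Under the product of
the marginals, the law of `X` is at most `(P/p)^(-p/2)` times Lebesgue measure, so the exponential
moment is at most `(P/p)^(-p/2) ∫ exp g` whatever the law of the output; this is
`le_mutualInfo_add`. Its logarithm yields `(p/2) log P`, and everything else is constant. Two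
finiteness facts remain: `exp g = (1 + ‖z‖²)^(-d/2)` is integrable in dimension `d - 1`, and `log (1
+ ‖N‖²)` has finite mean, by a polynomial bound on the Bessel function. -/

/-- The Donsker–Varadhan lower bound for the Kullback–Leibler divergence. -/
theorem integral_sub_log_integral_exp_le_klDiv {α : Type*} [MeasurableSpace α] {μ ν : Measure α}
    [IsProbabilityMeasure μ] [IsProbabilityMeasure ν] {f : α → ℝ} (hfμ : Integrable f μ)
    (hfν : Integrable (fun x => Real.exp (f x)) ν) :
    ((∫ x, f x ∂μ - Real.log (∫ x, Real.exp (f x) ∂ν) : ℝ) : EReal) ≤ (klDiv μ ν : EReal) := by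
  by_cases htop : klDiv μ ν = ∞
  · simp [htop]
  obtain ⟨hac, hint⟩ := klDiv_ne_top_iff.1 htop
  have : IsProbabilityMeasure (ν.tilted f) := isProbabilityMeasure_tilted hfν
  -- Gibbs' inequality for `μ` against the tilted measure: that divergence is `klDiv μ ν - ∫ f ∂μ +
  -- log ∫ exp f ∂ν`.
  have hnonneg := integral_llr_add_sub_measure_univ_nonneg
    (hac.trans (absolutelyContinuous_tilted hfν)) (integrable_llr_tilted_right hac hfμ hint hfν)
  rw [integral_llr_tilted_right hac hfμ hfν hint] at hnonneg
  have hreal : (klDiv μ ν).toReal = ∫ x, llr μ ν x ∂μ :=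
    toReal_klDiv_of_measure_eq hac (by simp)
  rw [← ENNReal.ofReal_toReal htop, EReal.coe_ennreal_ofReal, max_eq_left ENNReal.toReal_nonneg,
    EReal.coe_le_coe_iff, hreal]
  simp only [probReal_univ] at hnonneg
  linarith

/-! ### Domination of Gaussian laws by Lebesgue measure -/

theorem measure_pi_mono {ι : Type*} [Fintype ι] {α : ι → Type*}
    [∀ i, MeasurableSpace (α i)] {μ ν : ∀ i, Measure (α i)} (h : ∀ i, μ i ≤ ν i) :
    Measure.pi μ ≤ Measure.pi ν := by
  refine Measure.le_iff.2 fun s hs => ?_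
  rw [Measure.pi, Measure.pi, toMeasure_apply _ _ hs, toMeasure_apply _ _ hs]
  refine OuterMeasure.le_pi.2 (fun t _ => (OuterMeasure.pi_pi_le _ t).trans ?_) s
  exact Finset.prod_le_prod' fun i _ => h i (t i)

/-- The density is at most `1 / √(2π) ≤ 1`; discarding this constant costs only `O(1)` in the final
bound. -/
theorem gaussianReal_zero_one_le_volume : gaussianReal 0 1 ≤ volume := by
  rw [gaussianReal_of_var_ne_zero 0 one_ne_zero]
  conv_rhs => rw [← withDensity_one (μ := (volume : Measure ℝ))]
  refine withDensity_mono (ae_of_all _ fun x => ?_)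
  rw [gaussianPDF, Pi.one_apply, ENNReal.ofReal_le_one, gaussianPDFReal]
  refine mul_le_one₀ (inv_le_one_of_one_le₀ ?_) (Real.exp_nonneg _) ?_
  · rw [Real.one_le_sqrt]
    have := Real.pi_gt_three
    simp
    linarith
  · rw [Real.exp_le_one_iff]
    exact div_nonpos_of_nonpos_of_nonneg (neg_nonpos.2 (sq_nonneg _)) (by positivity)

theorem stdGaussian_le_volume {ι : Type*} [Fintype ι] :
    stdGaussian (EuclideanSpace ℝ ι) ≤ volume := by
  rw [← map_pi_eq_stdGaussian, ← (PiLp.volume_preserving_toLp ι).map_eq]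
  exact Measure.map_mono (measure_pi_mono fun _ => gaussianReal_zero_one_le_volume)
    (by fun_prop)

open scoped MatrixOrder in
theorem multivariateGaussian_zero_smul_one {ι : Type*} [Fintype ι] [DecidableEq ι] {s : ℝ}
    (hs : 0 ≤ s) :
    multivariateGaussian 0 (s • (1 : Matrix ι ι ℝ)) =
      (stdGaussian (EuclideanSpace ℝ ι)).map (fun x => √s • x) := by
  have hsqrt : CFC.sqrt (s • (1 : Matrix ι ι ℝ)) = √s • 1 := by
    apply CFC.sqrt_unique
    · rw [smul_mul_smul_comm, Real.mul_self_sqrt hs, one_mul]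
    · exact (Matrix.PosSemidef.one.smul (Real.sqrt_nonneg s)).nonneg
  rw [multivariateGaussian, hsqrt]
  congr 1
  ext1 x
  simp

/-- Dilation by `√s` scales the bound for the standard Gaussian by the Jacobian, which is the source
of the `(p/2) log P` term. -/
theorem multivariateGaussian_le_smul_volume {ι : Type*} [Fintype ι] [DecidableEq ι] {s : ℝ}
    (hs : 0 < s) :
    multivariateGaussian 0 (s • (1 : Matrix ι ι ℝ)) ≤
      ENNReal.ofReal ((√s ^ Fintype.card ι)⁻¹) •
        (volume : Measure (EuclideanSpace ℝ ι)) := by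
  rw [multivariateGaussian_zero_smul_one hs.le]
  refine (Measure.map_mono stdGaussian_le_volume (by fun_prop)).trans_eq ?_
  rw [Measure.map_addHaar_smul _ (Real.sqrt_pos.2 hs).ne', finrank_euclideanSpace,
    abs_of_nonneg (by positivity)]

/-! ### Tail of the noise density -/

/-- Raise `a / k ≤ exp (a / k)` to the power `k`. -/
theorem exp_neg_le_rpow_neg {k a : ℝ} (hk : 0 < k) (ha : 0 < a) :
    Real.exp (-a) ≤ k ^ k * a ^ (-k) := by
  have h : a / k ≤ Real.exp (a / k) := by linarith [Real.add_one_le_exp (a / k)]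
  have h2 := Real.rpow_le_rpow (by positivity) h hk.le
  rw [← Real.exp_mul, div_mul_cancel₀ _ hk.ne', Real.div_rpow ha.le hk.le,
    div_le_iff₀ (by positivity)] at h2
  rw [Real.exp_neg, Real.rpow_neg ha.le, inv_le_comm₀ (Real.exp_pos _) (by positivity), mul_inv,
    inv_inv, inv_mul_le_iff₀ (by positivity)]
  linarith

/-- Polynomial decay of the Bessel integral, with the exponent for which the remaining integral is
`∫ exp (-t)`. -/
theorem besselK_le {ν z : ℝ} (hν : 0 < ν) (hz : 0 < z) :
    besselK ν z ≤ (ν + 1) ^ (ν + 1) * (z / 2) ^ (-ν - 2) := by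
  have hν1 : 0 < ν + 1 := by linarith
  have key : ∫ t in Set.Ioi (0 : ℝ), Real.exp (-t - z ^ 2 / (4 * t)) * t ^ (-ν - 1) ≤
      (ν + 1) ^ (ν + 1) * (z ^ 2 / 4) ^ (-(ν + 1)) := by
    have hexp : ∫ t in Set.Ioi (0 : ℝ), (ν + 1) ^ (ν + 1) * (z ^ 2 / 4) ^ (-(ν + 1)) *
        Real.exp (-t) = (ν + 1) ^ (ν + 1) * (z ^ 2 / 4) ^ (-(ν + 1)) := by
      rw [integral_const_mul, integral_exp_neg_Ioi_zero, mul_one]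
    rw [← hexp]
    refine integral_mono_of_nonneg ?_ ((integrableOn_exp_neg_Ioi 0).const_mul _) ?_
    · filter_upwards [ae_restrict_mem measurableSet_Ioi] with t (ht : 0 < t)
      simp only [Pi.zero_apply]
      positivity
    · filter_upwards [ae_restrict_mem measurableSet_Ioi] with t (ht : 0 < t)
      have h := exp_neg_le_rpow_neg hν1 (show 0 < z ^ 2 / 4 / t by positivity)
      have hsplit : Real.exp (-t - z ^ 2 / (4 * t)) =
          Real.exp (-t) * Real.exp (-(z ^ 2 / 4 / t)) := by
        rw [← Real.exp_add, div_div]; rfl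
      rw [Real.div_rpow (by positivity) ht.le] at h
      have htpow : t ^ (-ν - 1) = t ^ (-(ν + 1)) := by congr 1; ring
      rw [hsplit, htpow, mul_assoc, mul_comm _ (Real.exp (-t))]
      refine mul_le_mul_of_nonneg_left ?_ (Real.exp_nonneg _)
      calc _ ≤ _ := mul_le_mul_of_nonneg_right h (by positivity)
        _ = _ := by
          have : t ^ (-(ν + 1)) ≠ 0 := by positivity
          field_simp
  have hz2 : (z ^ 2 / 4) ^ (-(ν + 1)) = (z / 2) ^ (-2 * (ν + 1)) := by
    rw [show z ^ 2 / 4 = (z / 2) ^ (2 : ℝ) by norm_num; ring, ← Real.rpow_mul (by positivity)]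
    congr 1; ring
  have hpow : (z / 2) ^ ν * (z / 2) ^ (-2 * (ν + 1)) = (z / 2) ^ (-ν - 2) := by
    rw [← Real.rpow_add (by positivity)]
    congr 1; ring
  calc besselK ν z ≤ 1 / 2 * (z / 2) ^ ν * ((ν + 1) ^ (ν + 1) * (z ^ 2 / 4) ^ (-(ν + 1))) :=
        mul_le_mul_of_nonneg_left key (by positivity)
    _ = 1 / 2 * ((ν + 1) ^ (ν + 1) * (z / 2) ^ (-ν - 2)) := by rw [hz2, ← hpow]; ring
    _ ≤ (ν + 1) ^ (ν + 1) * (z / 2) ^ (-ν - 2) := by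
        have : 0 < (ν + 1) ^ (ν + 1) * (z / 2) ^ (-ν - 2) := by positivity
        linarith

theorem exists_ndfhlPDF_le {d : ℕ} (hd : 0 < d) {lam u : ℝ} (hlam : 0 < lam) (hu : 0 < u) :
    ∃ C : ℝ, 0 ≤ C ∧ ∀ n, ndfhlPDF d lam u n ≤ C * (1 + ‖n‖ ^ 2) ^ (-(d : ℝ) / 2 - 1) := by
  have hd' : (0 : ℝ) < d := by exact_mod_cast hd
  set ν : ℝ := (d : ℝ) / 2 with hν
  have hνpos : 0 < ν := by positivity
  set A : ℝ := lam / ((2 : ℝ) ^ (ν - 1) * Real.pi ^ ν) with hA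
  -- Chosen so that `c (1 + ‖n‖²) ≤ ‖n‖² + lam²`.
  set c : ℝ := min 1 (lam ^ 2) with hc
  have hcpos : 0 < c := by positivity
  refine ⟨A * u ^ ν * Real.exp (lam * u) * ((ν + 1) ^ (ν + 1) * (u / 2) ^ (-ν - 2)) *
    c ^ (-ν - 1), by positivity, fun n => ?_⟩
  have hsq : 0 < ‖n‖ ^ 2 + lam ^ 2 := by positivity
  set ρ := ndfhlRho d lam n with hρ
  have hρpos : 0 < ρ := Real.sqrt_pos.2 hsq
  have hρpow : ρ ^ (-ν) * ρ ^ (-ν - 2) ≤ c ^ (-ν - 1) * (1 + ‖n‖ ^ 2) ^ (-ν - 1) := by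
    have h1 : ρ ^ (-ν) * ρ ^ (-ν - 2) = (‖n‖ ^ 2 + lam ^ 2) ^ (-ν - 1) := by
      rw [← Real.sq_sqrt hsq.le, ← Real.rpow_natCast, ← Real.rpow_mul (Real.sqrt_nonneg _),
        ← Real.rpow_add hρpos]
      congr 1
      push_cast
      ring
    rw [h1, ← Real.mul_rpow hcpos.le (by positivity)]
    refine Real.rpow_le_rpow_of_nonpos (by positivity) ?_ (by linarith)
    have := min_le_left 1 (lam ^ 2)
    have := min_le_right 1 (lam ^ 2)
    nlinarith [sq_nonneg ‖n‖]
  have hK := besselK_le hνpos (mul_pos hu hρpos)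
  have hneg : -(d : ℝ) / 2 - 1 = -ν - 1 := by rw [hν]; ring
  rw [hneg]
  calc ndfhlPDF d lam u n
      ≤ A * (u / ρ) ^ ν * Real.exp (lam * u) *
          ((ν + 1) ^ (ν + 1) * (u * ρ / 2) ^ (-ν - 2)) :=
        mul_le_mul_of_nonneg_left hK (by positivity)
    _ = A * u ^ ν * Real.exp (lam * u) * ((ν + 1) ^ (ν + 1) * (u / 2) ^ (-ν - 2)) *
          (ρ ^ (-ν) * ρ ^ (-ν - 2)) := by
        rw [show u * ρ / 2 = u / 2 * ρ by ring, Real.mul_rpow (by positivity) hρpos.le,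
          Real.div_rpow hu.le hρpos.le, Real.rpow_neg hρpos.le ν]
        ring
    _ ≤ _ := by
        rw [mul_assoc _ (c ^ _)]
        exact mul_le_mul_of_nonneg_left hρpow (by positivity)

/-- Since `log (1 + r) ≤ 1 + r`, the logarithm costs one power of `1 + ‖n‖²`, leaving the exponent
`-d/2`, still integrable in dimension `d - 1`. -/
theorem integrable_log_one_add_norm_sq_ndfhl {d : ℕ} (hd : 0 < d) {lam u : ℝ} (hlam : 0 < lam)
    (hu : 0 < u) : Integrable (fun n => Real.log (1 + ‖n‖ ^ 2)) (ndfhl d lam u) := by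
  obtain ⟨C, hC, hle⟩ := exists_ndfhlPDF_le hd hlam hu
  set g : EuclideanSpace ℝ (Fin (d - 1)) → ℝ :=
    fun n => C * (1 + ‖n‖ ^ 2) ^ (-(d : ℝ) / 2 - 1) with hg
  have hgm : Measurable g := by fun_prop
  -- Comparing measures instead of densities makes measurability of the Bessel density unnecessary.
  have hmono : ndfhl d lam u ≤ volume.withDensity fun n => ENNReal.ofReal (g n) :=
    withDensity_mono (ae_of_all _ fun n => ENNReal.ofReal_le_ofReal (hle n))
  have hd' : (0 : ℝ) < d := by exact_mod_cast hd
  have hfin : (Module.finrank ℝ (EuclideanSpace ℝ (Fin (d - 1))) : ℝ) < d := by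
    rw [finrank_euclideanSpace, Fintype.card_fin]
    exact_mod_cast Nat.sub_lt hd one_pos
  refine Integrable.mono_measure ?_ hmono
  rw [integrable_withDensity_iff hgm.ennreal_ofReal (ae_of_all _ fun _ => ENNReal.ofReal_lt_top)]
  refine ((integrable_rpow_neg_one_add_norm_sq hfin).const_mul C).mono'
    (by fun_prop) (ae_of_all _ fun n => ?_)
  have h1 : 1 ≤ 1 + ‖n‖ ^ 2 := by nlinarith [sq_nonneg ‖n‖]
  have hpos : 0 < 1 + ‖n‖ ^ 2 := by positivity
  have hlog : 0 ≤ Real.log (1 + ‖n‖ ^ 2) := Real.log_nonneg h1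
  have hlog' : Real.log (1 + ‖n‖ ^ 2) ≤ 1 + ‖n‖ ^ 2 := (Real.log_le_sub_one_of_pos hpos).trans
    (by linarith)
  have hgn : 0 ≤ g n := by positivity
  rw [ENNReal.toReal_ofReal hgn, Real.norm_of_nonneg (mul_nonneg hlog hgn)]
  calc _ ≤ (1 + ‖n‖ ^ 2) * g n := mul_le_mul_of_nonneg_right hlog' hgn
    _ = _ := by
      simp only [hg]
      rw [Real.rpow_sub_one hpos.ne']
      field_simp

/-! ### The additive noise channel -/

/-- For each fixed `y`, replace `κ` by `c • m`; reflection and translation invariance then remove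
`y`, so `ν` contributes only its mass `1`. -/
theorem integral_comp_sub_prod_le {E : Type*} [NormedAddCommGroup E] [MeasurableSpace E]
    [BorelSpace E] [SecondCountableTopology E] {m κ ν : Measure E} [m.IsAddLeftInvariant]
    [m.IsNegInvariant] [IsProbabilityMeasure κ] [IsProbabilityMeasure ν] {c : ℝ} (hc : 0 ≤ c)
    (hκ : κ ≤ ENNReal.ofReal c • m)
    {h : E → ℝ} (hh : Measurable h) (hnonneg : ∀ z, 0 ≤ h z) (hint : Integrable h m) :
    Integrable (fun q : E × E => h (q.2 - q.1)) (κ.prod ν) ∧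
      ∫ q, h (q.2 - q.1) ∂κ.prod ν ≤ c * ∫ z, h z ∂m := by
  have hmeas : Measurable fun q : E × E => h (q.2 - q.1) := by fun_prop
  have hbound : ∫⁻ q, ENNReal.ofReal (h (q.2 - q.1)) ∂κ.prod ν ≤
      ENNReal.ofReal (c * ∫ z, h z ∂m) := by
    rw [lintegral_prod_symm' _ hmeas.ennreal_ofReal]
    calc ∫⁻ y, ∫⁻ x, ENNReal.ofReal (h (y - x)) ∂κ ∂ν
        ≤ ∫⁻ _, ENNReal.ofReal (c * ∫ z, h z ∂m) ∂ν := by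
          refine lintegral_mono fun y => (lintegral_mono' hκ le_rfl).trans_eq ?_
          rw [lintegral_smul_measure,
            lintegral_sub_left_eq_self (fun z => ENNReal.ofReal (h z)) y,
            ← ofReal_integral_eq_lintegral_ofReal hint (ae_of_all _ hnonneg),
            ENNReal.ofReal_mul hc, smul_eq_mul]
      _ = _ := by simp
  have hI : Integrable (fun q : E × E => h (q.2 - q.1)) (κ.prod ν) := by
    refine ⟨hmeas.aestronglyMeasurable, ?_⟩
    rw [hasFiniteIntegral_iff_ofReal (ae_of_all _ fun _ => hnonneg _)]
    exact hbound.trans_lt ENNReal.ofReal_lt_top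
  refine ⟨hI, ?_⟩
  rw [← ENNReal.ofReal_le_ofReal_iff (mul_nonneg hc (integral_nonneg hnonneg)),
    ofReal_integral_eq_lintegral_ofReal hI (ae_of_all _ fun _ => hnonneg _)]
  exact hbound

/-- Lower bound on the information carried through an additive noise channel whose input law has
density at most `c`, in terms of a positive integrable test function of the noise. -/
theorem le_mutualInfo_add {Ω E : Type*} [MeasurableSpace Ω] {μ : Measure Ω}
    [IsProbabilityMeasure μ] [NormedAddCommGroup E] [MeasurableSpace E]
    [BorelSpace E] [SecondCountableTopology E] {m κ ν : Measure E} [m.IsAddLeftInvariant]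
    [m.IsNegInvariant] {X N : Ω → E} (hX : HasLaw X κ μ) (hN : HasLaw N ν μ) {c : ℝ} (hc : 0 < c)
    (hκ : κ ≤ ENNReal.ofReal c • m) {g : E → ℝ} (hg : Measurable g) (hgν : Integrable g ν)
    (hint : Integrable (fun z => Real.exp (g z)) m) :
    ((∫ z, g z ∂ν - Real.log (c * ∫ z, Real.exp (g z) ∂m) : ℝ) : EReal) ≤
      (mutualInfo X (fun ω => X ω + N ω) μ : EReal) := by
  have hXm := hX.aemeasurable
  have hYm : AEMeasurable (fun ω => X ω + N ω) μ := hXm.add hN.aemeasurable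
  have hJm : AEMeasurable (fun ω => (X ω, X ω + N ω)) μ := hXm.prodMk hYm
  have := Measure.isProbabilityMeasure_map hXm
  have := Measure.isProbabilityMeasure_map hYm
  have := Measure.isProbabilityMeasure_map hJm
  have hmeas : Measurable fun q : E × E => g (q.2 - q.1) := by fun_prop
  -- On the joint law, output minus input is exactly the noise.
  have hcomp : (fun q : E × E => g (q.2 - q.1)) ∘ (fun ω => (X ω, X ω + N ω)) = g ∘ N := by
    ext ω; simp
  rw [← hN.map_eq] at hgν
  have hgJ : Integrable (fun q : E × E => g (q.2 - q.1)) (μ.map fun ω => (X ω, X ω + N ω)) := by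
    rw [integrable_map_measure hmeas.aestronglyMeasurable hJm, hcomp]
    exact (integrable_map_measure hg.aestronglyMeasurable hN.aemeasurable).1 hgν
  have hgJeq : ∫ q, g (q.2 - q.1) ∂(μ.map fun ω => (X ω, X ω + N ω)) = ∫ z, g z ∂ν := by
    rw [integral_map hJm hmeas.aestronglyMeasurable, ← hN.map_eq,
      integral_map hN.aemeasurable hg.aestronglyMeasurable]
    simp
  obtain ⟨hI, hle⟩ := integral_comp_sub_prod_le (κ := μ.map X)
    (ν := μ.map fun ω => X ω + N ω) hc.le (hX.map_eq ▸ hκ) hg.exp (fun z => Real.exp_nonneg (g z))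
    hint
  refine le_trans ?_ (integral_sub_log_integral_exp_le_klDiv hgJ hI)
  rw [EReal.coe_le_coe_iff, hgJeq]
  exact sub_le_sub_left (Real.log_le_log (integral_exp_pos hI) hle) _

theorem mainTheorem3 (d : ℕ) (hd : 2 ≤ d) (lam u : ℝ) (hlam : 0 < lam) (hu : 0 < u) :
    ∃ r : ℝ → ℝ, r =O[atTop] (fun _ => (1 : ℝ)) ∧
      ∀ᶠ P : ℝ in atTop,
        ∀ (Ω : Type*) [MeasurableSpace Ω] (μ : Measure Ω) [IsProbabilityMeasure μ]
          (X N : Ω → EuclideanSpace ℝ (Fin (d - 1))),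
          HasLaw X (multivariateGaussian 0 ((P / ((d : ℝ) - 1)) • 1)) μ →
          HasLaw N (ndfhl d lam u) μ →
          IndepFun X N μ →
          ((((d : ℝ) - 1) / 2 * Real.log P + r P : ℝ) : EReal) ≤
            (mutualInfo X (fun ω => X ω + N ω) μ : EReal) := by

  have hd0 : 0 < d := by omega
  have hp : 0 < (d : ℝ) - 1 := by
    have : (2 : ℝ) ≤ d := by exact_mod_cast hd
    linarith
  set g : EuclideanSpace ℝ (Fin (d - 1)) → ℝ :=
    fun z => -(d : ℝ) / 2 * Real.log (1 + ‖z‖ ^ 2) with hgdef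
  have hg : Measurable g := by fun_prop
  have hgν : Integrable g (ndfhl d lam u) :=
    (integrable_log_one_add_norm_sq_ndfhl hd0 hlam hu).const_mul _
  have hfin : (Module.finrank ℝ (EuclideanSpace ℝ (Fin (d - 1))) : ℝ) < d := by
    rw [finrank_euclideanSpace, Fintype.card_fin]
    exact_mod_cast Nat.sub_lt hd0 one_pos
  have hint : Integrable (fun z => Real.exp (g z)) := by
    refine (integrable_rpow_neg_one_add_norm_sq hfin).congr (ae_of_all _ fun z => ?_)
    simp only [hgdef]
    rw [Real.rpow_def_of_pos (by positivity), mul_comm]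
  have hH := integral_exp_pos hint
  -- The remainder is constant in `P`; its last term comes from the variance being `P / (d - 1)` per
  -- coordinate.
  refine ⟨fun _ => ∫ z, g z ∂ndfhl d lam u - Real.log (∫ z, Real.exp (g z)) -
    ((d : ℝ) - 1) / 2 * Real.log ((d : ℝ) - 1), isBigO_const_const _ one_ne_zero _, ?_⟩
  filter_upwards [eventually_gt_atTop 0] with P hP Ω _ μ _ X N hX hN _
  have hs : 0 < P / ((d : ℝ) - 1) := by positivity
  have hbound := le_mutualInfo_add hX hN (by positivity)
    (multivariateGaussian_le_smul_volume hs) hg hgν hint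
  refine le_trans (le_of_eq ?_) hbound
  rw [EReal.coe_eq_coe_iff, Fintype.card_fin, Real.log_mul (by positivity) hH.ne', Real.log_inv,
    Real.log_pow, Real.log_sqrt hs.le, Real.log_div hP.ne' hp.ne', Nat.cast_sub (by omega)]
  push_cast
  ring
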